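/- Proposition 4.1. Let $G$ be a countable discrete group. Call $G$ inner amenable if there is a finitely additive probability measure $m$ defined on all subsets of $G$ such that $m(gAg^{-1}) = m(A)$ for all $g \in G$, $A \subset G$, and $m(F) = 0$ for every finite $F \subset G$. Call a II$_1$ factor $M$ with trace $\tau$ and $\|x\|_2 = \sqrt{\tau(x^*x)}$ McDuff if $M' \cap M^\omega$ is non abelian for some free ultrafilter $\omega$ on $\mathbb{N}$: there are operator-norm bounded sequences $(x_n), (y_n)$ in $M$ with $\lim_{\omega} \|x_n a - a x_n\|_2 = 0 = \lim_{\omega} \|y_n a - a y_n\|_2$ for all $a \in M$, while $\|x_n y_n - y_n x_n\|_2$ does not tend to $0$ along $\omega$. Call $G$ McDuff if it admits an essentially free ergodic probability measure preserving action on a standard probability space $(X,\mu)$ such that the crossed product $L^\infty(X) \rtimes G$ is a McDuff II$_1$ factor. (1) If $G$ is McDuff, then $G$ is inner amenable. (2) If $G$ is not inner amenable, then for every essentially free ergodic probability measure preserving action of $G$ on a standard probability space $(X,\mu)$, writing $A = L^\infty(X)$, $M = A \rtimes G$, $\tau$ for the canonical trace of $M$ and $E_A : M \to A$ for the $\tau$-preserving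 conditional expectation: every bounded sequence $(x_n)$ in $M$ with $\lim_n \|x_n a - a x_n\|_2 = 0$ for all $a \in M$ satisfies $\lim_n \|x_n - E_A(x_n)\|_2 = 0$; and $M$ is not a McDuff II$_1$ factor. -/

import Mathlib

open MeasureTheory Filter Topology
open scoped ENNReal

universe u v

noncomputable section

/-! ### Inner amenability -/

/-- A conjugation invariant mean on the discrete group `G` (a finitely additive probability
measure on all subsets of `G`) which vanishes on every finite subset. -/
structure IsDiffuseConjInvariantMean {G : Type u} [Group G] (m : Set G → ℝ) : Prop where
  nonneg : ∀ A, 0 ≤ m A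
  univ : m Set.univ = 1
  union : ∀ A B, Disjoint A B → m (A ∪ B) = m A + m B
  conj_invariant : ∀ (g : G) (A : Set G), m ((fun h => g * h * g⁻¹) '' A) = m A
  finite : ∀ A : Set G, A.Finite → m A = 0

/-- `G` is inner amenable: there is a conjugation invariant mean on `G` giving weight zero to all
finite subsets of `G`. -/
def IsInnerAmenable (G : Type u) [Group G] : Prop :=
  ∃ m : Set G → ℝ, IsDiffuseConjInvariantMean m

/-! ### Tracial von Neumann algebras, II₁ factors and the McDuff property -/

section VonNeumann

variable {H : Type u} [NormedAddCommGroup H] [InnerProductSpace ℂ H] [CompleteSpace H]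

/-- The von Neumann algebra generated by a set `S` of bounded operators: the double commutant of
`S ∪ S*`. -/
def VonNeumannAlgebra.generatedBy (S : Set (H →L[ℂ] H)) : VonNeumannAlgebra H where
  toStarSubalgebra := StarSubalgebra.centralizer ℂ (StarSubalgebra.centralizer ℂ S : Set (H →L[ℂ] H))
  centralizer_centralizer' := by
    change Set.centralizer (Set.centralizer
      (StarSubalgebra.centralizer ℂ (StarSubalgebra.centralizer ℂ S : Set (H →L[ℂ] H)) :
        Set (H →L[ℂ] H))) =
      (StarSubalgebra.centralizer ℂ (StarSubalgebra.centralizer ℂ S : Set (H →L[ℂ] H)) :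
        Set (H →L[ℂ] H))
    rw [StarSubalgebra.coe_centralizer_centralizer, Set.centralizer_centralizer_centralizer]

/-- The underlying *-algebra of a von Neumann algebra, as a type. -/
abbrev VonNeumannAlgebra.Elem (M : VonNeumannAlgebra H) : Type u := M.toStarSubalgebra

/-- `τ` is a faithful normal tracial state on `M`. Normality means that `τ` preserves suprema of
upwards directed sets of positive elements, for the usual order on self-adjoint operators. -/
structure IsFaithfulNormalTrace (M : VonNeumannAlgebra H) (τ : M.Elem →ₗ[ℂ] ℂ) : Prop where
  map_one : τ 1 = 1
  nonneg : ∀ x, 0 ≤ (τ (star x * x)).re ∧ (τ (star x * x)).im = 0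
  trace : ∀ x y, τ (x * y) = τ (y * x)
  faithful : ∀ x, τ (star x * x) = 0 → x = 0
  normal : ∀ (D : Set M.Elem) (x : M.Elem), D.Nonempty →
    (∀ y ∈ D, (0 : H →L[ℂ] H) ≤ y) →
    DirectedOn (fun y z : M.Elem => (y : H →L[ℂ] H) ≤ z) D →
    IsLUB ((fun y : M.Elem => (y : H →L[ℂ] H)) '' D) (x : H →L[ℂ] H) →
    IsLUB ((fun y => (τ y).re) '' D) (τ x).re

/-- The tracial von Neumann algebra `(M, τ)` is a II₁ factor: `M` has trivial center, is infinite
dimensional, and `τ` is a faithful normal tracial state (necessarily the only one). -/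
structure IsII1Factor (M : VonNeumannAlgebra H) (τ : M.Elem →ₗ[ℂ] ℂ) : Prop where
  factor : ∀ z : M.Elem, (∀ x : M.Elem, z * x = x * z) → ∃ c : ℂ, z = algebraMap ℂ M.Elem c
  infinite_dimensional : ¬ FiniteDimensional ℂ M.Elem
  trace : IsFaithfulNormalTrace M τ

/-- `‖x‖₂ = √τ(x* x)`. -/
def twoNorm {M : VonNeumannAlgebra H} (τ : M.Elem →ₗ[ℂ] ℂ) (x : M.Elem) : ℝ :=
  √(τ (star x * x)).re

/-- The sequence `x` in `M` is bounded in operator norm and `‖x n * a - a * x n‖₂ → 0` along the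
filter `l` for every `a ∈ M`. For `l = atTop` these are the central sequences of `M`; for a free
ultrafilter `l = ω` these are the representatives of the elements of `M' ∩ M^ω`. -/
structure IsCentralSequence {M : VonNeumannAlgebra H} (τ : M.Elem →ₗ[ℂ] ℂ) (l : Filter ℕ)
    (x : ℕ → M.Elem) : Prop where
  bounded : ∃ C : ℝ, ∀ n, ‖(x n : H →L[ℂ] H)‖ ≤ C
  central : ∀ a : M.Elem, Tendsto (fun n => twoNorm τ (x n * a - a * x n)) l (𝓝 0)

/-- The central sequence algebra `M' ∩ M^ω` is not abelian. Here `M^ω` is the tracial ultrapower: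
bounded sequences in `M` modulo those with `‖x n‖₂ → 0` along `ω`. -/
def HasNonabelianCentralSequenceAlgebra {M : VonNeumannAlgebra H} (τ : M.Elem →ₗ[ℂ] ℂ)
    (ω : Ultrafilter ℕ) : Prop :=
  ∃ x y : ℕ → M.Elem, IsCentralSequence τ ω x ∧ IsCentralSequence τ ω y ∧
    ¬ Tendsto (fun n => twoNorm τ (x n * y n - y n * x n)) ω (𝓝 0)

/-- `(M, τ)` is a McDuff II₁ factor: a II₁ factor such that `M' ∩ M^ω` is non abelian for some free
ultrafilter `ω` on `ℕ` (for `M` with separable predual, equivalently for every such `ω`). -/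
def IsMcDuffFactor (M : VonNeumannAlgebra H) (τ : M.Elem →ₗ[ℂ] ℂ) : Prop :=
  IsII1Factor M τ ∧ ∃ ω : Ultrafilter ℕ, (ω : Filter ℕ) ≤ cofinite ∧
    HasNonabelianCentralSequenceAlgebra τ ω

end VonNeumann

/-! ### The group measure space construction -/

/-- A group action on a measure space is (essentially) free: every non trivial group element
fixes almost no point. -/
def IsEssentiallyFree (G : Type u) [Group G] {X : Type v} [MeasurableSpace X] [MulAction G X]
    (μ : Measure X) : Prop :=
  ∀ g : G, g ≠ 1 → ∀ᵐ s ∂μ, g • s ≠ s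

namespace GroupMeasureSpace

section

variable (G : Type u) [Group G] {X : Type v} [MeasurableSpace X] [MulAction G X]
  [MeasurableConstSMul G X] (μ : Measure X) [IsProbabilityMeasure μ] [SMulInvariantMeasure G X μ]

/-- The Hilbert space `ℓ²(G, L²(X)) = L²(X) ⊗ ℓ²(G)`. -/
abbrev Space (G : Type u) {X : Type v} [MeasurableSpace X] (μ : Measure X) : Type (max u v) :=
  lp (fun _ : G => Lp ℂ 2 μ) 2

variable {μ}

/-- Multiplication by `f ∈ L^∞(X)` on `L²(X)`. -/
def mulL2 (f : Lp ℂ ∞ μ) : Lp ℂ 2 μ →L[ℂ] Lp ℂ 2 μ :=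
  (ContinuousLinearMap.mul ℂ ℂ).holderL μ ∞ 2 2 f

/-- `f ∈ L^∞(X)` acting as `f ⊗ 1` on `L²(X) ⊗ ℓ²(G)`. -/
def mulOp (f : Lp ℂ ∞ μ) : Space G μ →L[ℂ] Space G μ :=
  lp.mapCLM 2 (fun _ : G => mulL2 f) (norm_nonneg (mulL2 f)) (fun _ => le_rfl)

variable (μ)

variable {G}

/-- The Koopman operator `(σ_g ξ)(s) = ξ (g⁻¹ s)` on `L²(X)`. -/
def koopman (g : G) : Lp ℂ 2 μ →ₗᵢ[ℂ] Lp ℂ 2 μ :=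
  Lp.compMeasurePreservingₗᵢ ℂ (fun s => g⁻¹ • s) (measurePreserving_smul g⁻¹ μ)

/-- The canonical unitary `u_g = σ_g ⊗ λ_g`, that is `(u_g ξ)(h) = σ_g (ξ (g⁻¹ h))`. -/
def groupOp (g : G) : Space G μ →L[ℂ] Space G μ :=
  LinearMap.mkContinuous
    { toFun := fun ξ => ⟨fun h => koopman μ g (ξ (g⁻¹ * h)), by
        apply memℓp_gen
        have h1 := (lp.memℓp ξ).summable (by norm_num : 0 < (2 : ℝ≥0∞).toReal)
        simpa using! (Equiv.mulLeft g⁻¹).summable_iff.2 h1⟩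
      map_add' := fun ξ η => by ext1; funext h; simp; rfl
      map_smul' := fun c ξ => by ext1; funext h; simp }
    1
    (fun ξ => by
      have h2 : 0 < (2 : ℝ≥0∞).toReal := by norm_num
      rw [one_mul, lp.norm_eq_tsum_rpow h2, lp.norm_eq_tsum_rpow h2 ξ,
        ← (Equiv.mulLeft g⁻¹).tsum_eq (fun h => ‖ξ h‖ ^ (2 : ℝ≥0∞).toReal)]
      simp)

variable (G)

/-- The crossed product `L^∞(X) ⋊ G`: the von Neumann algebra on `L²(X) ⊗ ℓ²(G)` generated by
`L^∞(X)` and the unitaries `u_g`, `g ∈ G`. -/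
def crossedProduct : VonNeumannAlgebra (Space G μ) :=
  VonNeumannAlgebra.generatedBy
    (Set.range (mulOp G : Lp ℂ ∞ μ → _) ∪ Set.range (groupOp μ : G → _))

/-- The inclusion `L^∞(X) ⊆ L^∞(X) ⋊ G`. -/
def ofLinfty (f : Lp ℂ ∞ μ) : (crossedProduct G μ).Elem :=
  ⟨mulOp G f, StarAlgebra.adjoin_le_centralizer_centralizer ℂ _
    (StarAlgebra.subset_adjoin ℂ _ (Or.inl ⟨f, rfl⟩))⟩

open scoped Classical in
/-- The vector `1 ⊗ δ_e`. -/
def vacuum : Space G μ :=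
  lp.single 2 (1 : G) (Lp.const 2 μ (1 : ℂ))

/-- The canonical trace on `L^∞(X) ⋊ G`, given by `τ(x) = ⟨1 ⊗ δ_e, x (1 ⊗ δ_e)⟩`, so that
`τ(∑ a_g u_g) = ∫ a_e dμ`. -/
def trace : (crossedProduct G μ).Elem →ₗ[ℂ] ℂ where
  toFun x := inner ℂ (vacuum G μ) ((x : Space G μ →L[ℂ] Space G μ) (vacuum G μ))
  map_add' x y := by simp
  map_smul' c x := by simp

/-- `a = E_A(x)`, where `E_A` is the unique trace preserving conditional expectation of
`L^∞(X) ⋊ G` onto `A = L^∞(X)`: the element of `A` with `τ(b x) = τ(b a)` for all `b ∈ A`. -/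
def IsExpectation (x : (crossedProduct G μ).Elem) (a : Lp ℂ ∞ μ) : Prop :=
  ∀ b : Lp ℂ ∞ μ, trace G μ (ofLinfty G μ b * x) = trace G μ (ofLinfty G μ b * ofLinfty G μ a)

end

end GroupMeasureSpace

/-- A (countable) group `G` is McDuff if it admits a free ergodic probability measure preserving
action on a standard probability space such that `L^∞(X) ⋊ G` is a McDuff II₁ factor. -/
def IsMcDuffGroup (G : Type u) [Group G] : Prop :=
  ∃ (X : Type v) (_ : MeasurableSpace X) (_ : StandardBorelSpace X) (_ : MulAction G X)
    (_ : MeasurableConstSMul G X) (μ : Measure X) (_ : IsProbabilityMeasure μ)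
    (_ : ErgodicSMul G X μ),
    IsEssentiallyFree G μ ∧
    IsMcDuffFactor (GroupMeasureSpace.crossedProduct G μ) (GroupMeasureSpace.trace G μ)

end

/-!
Write `ξ_x = x (1 ⊗ δ_e) ∈ ℓ²(G, L²(X))` for the vector of Fourier coefficients of
`x ∈ M = L^∞(X) ⋊ G` (`coeffVec`). Then `‖x‖₂ = ‖ξ_x‖`. The right multiplications by elements of
`L^∞(X)` and by the unitaries `u_g` lie in the commutant of `M`, so that commutators of `x` with
`L^∞(X)` and with `u_g` can be computed coefficient by coefficient (`apply_rightMulOp`,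
`apply_rightGroupOp`). They also give `|ξ_x(g)| ≤ ‖x‖` almost everywhere
(`norm_coeffVec_apply_le`), hence `E_A(x) = ξ_x(e)` lies in `L^∞(X)`, and `‖x - E_A(x)‖₂` is the norm
of `ξ_x` restricted to `G \ {e}`.

Let `(x_n)` be a central sequence for which `‖x_n - E_A(x_n)‖₂` does not tend to zero. Along a
suitable ultrafilter this norm is bounded below, and the probability measures on `G \ {e}` with
density proportional to `‖ξ_{x_n}(h)‖²` (`offDiagMass`) converge to a finitely additive probability
measure. It is conjugation invariant because `x_n` almost commutes with `u_g`
(`abs_offDiagMass_conj_sub_le`). It vanishes on finite sets because `x_n` almost commutes with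
`L^∞(X)`: commuting with indicator functions `1_U` forces `ξ_{x_n}(g)` to be small where exactly one of
`s`, `g⁻¹ s` lies in `U`, and by freeness countably many such sets cover almost all of `X` if `g ≠ e`
(`IsCentralSequence.tendsto_norm_coeffVec_apply`). So `G` is inner amenable
(`isInnerAmenable_of_isCentralSequence`).

Consequently, if `G` is not inner amenable, central sequences along any filter are asymptotically
contained in the commutative algebra `L^∞(X)`, so any two of them asymptotically commute
(`twoNorm_commutator_le`) and `M` is not McDuff.
-/

noncomputable section

/-! ### Operators on `ℓ²(G, L²(X))` and the commutant of the crossed product -/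

namespace GroupMeasureSpace

section L2

variable {X : Type v} [MeasurableSpace X] {μ : Measure X}

theorem coeFn_mulL2 (f : Lp ℂ ∞ μ) (ξ : Lp ℂ 2 μ) :
    mulL2 f ξ =ᵐ[μ] fun s => f s * ξ s :=
  (ContinuousLinearMap.mul ℂ ℂ).coeFn_holder (p := ∞) (q := 2) (r := 2) f ξ

theorem norm_mulL2_le (f : Lp ℂ ∞ μ) : ‖mulL2 f‖ ≤ ‖f‖ := by
  refine ContinuousLinearMap.opNorm_le_bound _ (norm_nonneg f) fun ξ => ?_
  refine ((ContinuousLinearMap.mul ℂ ℂ).norm_holder_apply_apply_le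
    (p := ∞) (q := 2) (r := 2) f ξ).trans ?_
  gcongr
  calc ‖ContinuousLinearMap.mul ℂ ℂ‖ * ‖f‖ ≤ 1 * ‖f‖ := by
        gcongr; exact ContinuousLinearMap.opNorm_mul_le ℂ ℂ
    _ = ‖f‖ := one_mul _

theorem mulL2_comm (f g : Lp ℂ ∞ μ) (ξ : Lp ℂ 2 μ) :
    mulL2 f (mulL2 g ξ) = mulL2 g (mulL2 f ξ) := by
  apply Lp.ext
  filter_upwards [coeFn_mulL2 f (mulL2 g ξ), coeFn_mulL2 g (mulL2 f ξ), coeFn_mulL2 f ξ,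
    coeFn_mulL2 g ξ] with s h1 h2 h3 h4
  rw [h1, h2, h3, h4]
  ring

theorem inner_mulL2_left (f : Lp ℂ ∞ μ) (ξ η : Lp ℂ 2 μ) :
    inner ℂ (mulL2 f ξ) η = inner ℂ ξ (mulL2 (star f) η) := by
  rw [L2.inner_def, L2.inner_def]
  refine integral_congr_ae ?_
  filter_upwards [coeFn_mulL2 f ξ, coeFn_mulL2 (star f) η, Lp.coeFn_star f] with s h1 h2 h3
  rw [h1, h2, h3]
  simp only [RCLike.inner_apply, map_mul, Pi.star_apply, RCLike.star_def]
  ring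

end L2

section Operators

variable {G : Type u} {X : Type v} [MeasurableSpace X] {μ : Measure X}

theorem mulOp_apply (f : Lp ℂ ∞ μ) (ξ : Space G μ) (k : G) :
    mulOp G f ξ k = mulL2 f (ξ k) := rfl

theorem star_mulOp (f : Lp ℂ ∞ μ) : star (mulOp G f) = mulOp G (star f) := by
  rw [ContinuousLinearMap.star_eq_adjoint, eq_comm, ContinuousLinearMap.eq_adjoint_iff]
  intro ξ η
  rw [lp.inner_eq_tsum, lp.inner_eq_tsum]
  refine tsum_congr fun k => ?_
  rw [mulOp_apply, mulOp_apply, inner_mulL2_left, star_star]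

variable [Group G]

/-- Right multiplication by `u_{g⁻¹}`: the operator `(ξ u_{g⁻¹})(k) = ξ (k g)`. -/
def rightGroupOp (g : G) : Space G μ →L[ℂ] Space G μ :=
  LinearMap.mkContinuous
    { toFun := fun ξ => ⟨fun h => ξ (h * g), by
        apply memℓp_gen
        have h1 := (lp.memℓp ξ).summable (by norm_num : 0 < (2 : ℝ≥0∞).toReal)
        simpa using! (Equiv.mulRight g).summable_iff.2 h1⟩
      map_add' := fun ξ η => rfl
      map_smul' := fun c ξ => rfl }
    1
    (fun ξ => by
      have h2 : 0 < (2 : ℝ≥0∞).toReal := by norm_num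
      rw [one_mul, lp.norm_eq_tsum_rpow h2, lp.norm_eq_tsum_rpow h2 ξ,
        ← (Equiv.mulRight g).tsum_eq (fun h => ‖ξ h‖ ^ (2 : ℝ≥0∞).toReal)]
      rfl)

theorem rightGroupOp_apply (g : G) (ξ : Space G μ) (k : G) :
    rightGroupOp g ξ k = ξ (k * g) := rfl

section Vacuum

variable [IsProbabilityMeasure μ]

open scoped Classical in
theorem vacuum_apply_one : vacuum G μ 1 = Lp.const 2 μ (1 : ℂ) :=
  lp.single_apply_self ..

open scoped Classical in
theorem vacuum_apply_of_ne {k : G} (hk : k ≠ 1) : vacuum G μ k = 0 :=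
  lp.single_apply_ne _ _ _ hk

open scoped Classical in
theorem norm_vacuum : ‖vacuum G μ‖ = 1 := by
  rw [vacuum, lp.norm_single (by norm_num), Lp.norm_const _ _ _ (by norm_num)]
  simp

end Vacuum

variable [MulAction G X] [MeasurableConstSMul G X] [SMulInvariantMeasure G X μ]

/-- The action `(σ_g f)(s) = f (g⁻¹ s)` of `G` on `L^∞(X)`. -/
def translate (g : G) (f : Lp ℂ ∞ μ) : Lp ℂ ∞ μ :=
  Lp.compMeasurePreserving (fun s => g⁻¹ • s) (measurePreserving_smul g⁻¹ μ) f

theorem coeFn_translate (g : G) (f : Lp ℂ ∞ μ) :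
    translate g f =ᵐ[μ] fun s => f (g⁻¹ • s) :=
  Lp.coeFn_compMeasurePreserving f (measurePreserving_smul g⁻¹ μ)

theorem norm_translate (g : G) (f : Lp ℂ ∞ μ) : ‖translate g f‖ = ‖f‖ :=
  Lp.norm_compMeasurePreserving f (measurePreserving_smul g⁻¹ μ)

theorem translate_one (f : Lp ℂ ∞ μ) : translate (1 : G) f = f := by
  apply Lp.ext
  filter_upwards [coeFn_translate (1 : G) f] with s h1
  rw [h1, inv_one, one_smul]

theorem coeFn_koopman (g : G) (ξ : Lp ℂ 2 μ) :
    koopman μ g ξ =ᵐ[μ] fun s => ξ (g⁻¹ • s) :=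
  Lp.coeFn_compMeasurePreserving ξ (measurePreserving_smul g⁻¹ μ)

theorem koopman_koopman (g h : G) (ξ : Lp ℂ 2 μ) :
    koopman μ g (koopman μ h ξ) = koopman μ (g * h) ξ := by
  apply Lp.ext
  filter_upwards [coeFn_koopman g (koopman μ h ξ), coeFn_koopman (g * h) ξ,
    (measurePreserving_smul g⁻¹ μ).quasiMeasurePreserving.ae (coeFn_koopman h ξ)] with s h1 h2 h3
  rw [h1, h2, h3, mul_inv_rev, mul_smul]

theorem koopman_one (ξ : Lp ℂ 2 μ) : koopman μ (1 : G) ξ = ξ := by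
  apply Lp.ext
  filter_upwards [coeFn_koopman (1 : G) ξ] with s h1
  rw [h1, inv_one, one_smul]

theorem koopman_mulL2_translate (g k : G) (f : Lp ℂ ∞ μ) (ξ : Lp ℂ 2 μ) :
    koopman μ g (mulL2 (translate k f) ξ) = mulL2 (translate (g * k) f) (koopman μ g ξ) := by
  have hq := (measurePreserving_smul g⁻¹ μ).quasiMeasurePreserving
  apply Lp.ext
  filter_upwards [coeFn_koopman g (mulL2 (translate k f) ξ), coeFn_koopman g ξ,
    coeFn_mulL2 (translate (g * k) f) (koopman μ g ξ), coeFn_translate (g * k) f,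
    hq.ae (coeFn_mulL2 (translate k f) ξ), hq.ae (coeFn_translate k f)] with s h1 h2 h3 h4 h5 h6
  rw [h1, h3, h2, h4, h5, h6, mul_inv_rev, mul_smul]

theorem groupOp_apply (g : G) (ξ : Space G μ) (k : G) :
    groupOp μ g ξ k = koopman μ g (ξ (g⁻¹ * k)) := rfl

theorem groupOp_mul_groupOp (g h : G) : groupOp μ g * groupOp μ h = groupOp μ (g * h) := by
  ext1 ξ
  ext1
  funext k
  rw [mul_apply_eq_comp, groupOp_apply, groupOp_apply, groupOp_apply, koopman_koopman,
    mul_inv_rev, mul_assoc]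

theorem groupOp_one : groupOp μ (1 : G) = 1 := by
  ext1 ξ
  ext1
  funext k
  rw [groupOp_apply, koopman_one, inv_one, one_mul, one_apply_eq_self]

theorem inner_groupOp_groupOp (g : G) (ξ η : Space G μ) :
    inner ℂ (groupOp μ g ξ) (groupOp μ g η) = inner ℂ ξ η := by
  rw [lp.inner_eq_tsum, lp.inner_eq_tsum,
    ← (Equiv.mulLeft g⁻¹).tsum_eq (fun k => inner ℂ (ξ k) (η k))]
  refine tsum_congr fun k => ?_
  rw [groupOp_apply, groupOp_apply, LinearIsometry.inner_map_map]
  rfl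

theorem norm_groupOp_apply (g : G) (ξ : Space G μ) : ‖groupOp μ g ξ‖ = ‖ξ‖ := by
  rw [@norm_eq_sqrt_re_inner ℂ, @norm_eq_sqrt_re_inner ℂ, inner_groupOp_groupOp]

theorem star_groupOp (g : G) : star (groupOp μ g) = groupOp μ g⁻¹ := by
  rw [ContinuousLinearMap.star_eq_adjoint, eq_comm, ContinuousLinearMap.eq_adjoint_iff]
  intro ξ η
  rw [← inner_groupOp_groupOp g, ← mul_apply_eq_comp, groupOp_mul_groupOp,
    mul_inv_cancel, groupOp_one, one_apply_eq_self]

/-- Right multiplication by `f ∈ L^∞(X)`: writing vectors as `∑ ξ(k) u_k`, the operator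
`(ξ f)(k) = ξ(k) σ_k(f)`. -/
def rightMulOp (f : Lp ℂ ∞ μ) : Space G μ →L[ℂ] Space G μ :=
  lp.mapCLM 2 (fun k : G => mulL2 (translate k f)) (norm_nonneg f)
    (fun k => (norm_mulL2_le _).trans (norm_translate k f).le)

theorem rightMulOp_apply (f : Lp ℂ ∞ μ) (ξ : Space G μ) (k : G) :
    rightMulOp f ξ k = mulL2 (translate k f) (ξ k) := rfl

theorem norm_rightMulOp_le (f : Lp ℂ ∞ μ) : ‖rightMulOp (G := G) f‖ ≤ ‖f‖ :=
  lp.norm_mapCLM_le ..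

/-- An operator commuting with `L^∞(X)` and all `u_g` lies in the commutant of the crossed
product. -/
theorem crossedProduct_commute {T : Space G μ →L[ℂ] Space G μ}
    (hf : ∀ f : Lp ℂ ∞ μ, mulOp G f * T = T * mulOp G f)
    (hg : ∀ g : G, groupOp μ g * T = T * groupOp μ g) (x : (crossedProduct G μ).Elem)
    (ξ : Space G μ) :
    (x : Space G μ →L[ℂ] Space G μ) (T ξ) = T ((x : Space G μ →L[ℂ] Space G μ) ξ) := by
  have hx : (x : Space G μ →L[ℂ] Space G μ) ∈ StarSubalgebra.centralizer ℂ
    (StarSubalgebra.centralizer ℂ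
      (Set.range (mulOp G : Lp ℂ ∞ μ → _) ∪ Set.range (groupOp μ : G → _)) :
      Set (Space G μ →L[ℂ] Space G μ)) := x.2
  have hT : T ∈ StarSubalgebra.centralizer ℂ
      (Set.range (mulOp G : Lp ℂ ∞ μ → _) ∪ Set.range (groupOp μ : G → _)) := by
    rw [StarSubalgebra.mem_centralizer_iff]
    rintro _ (⟨f, rfl⟩ | ⟨g, rfl⟩)
    · exact ⟨hf f, by rw [star_mulOp]; exact hf _⟩
    · exact ⟨hg g, by rw [star_groupOp]; exact hg _⟩
  have h := ((StarSubalgebra.mem_centralizer_iff ℂ).1 hx T hT).1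
  exact (DFunLike.congr_fun h ξ).symm

theorem apply_rightMulOp (x : (crossedProduct G μ).Elem) (f : Lp ℂ ∞ μ) (ξ : Space G μ) :
    (x : Space G μ →L[ℂ] Space G μ) (rightMulOp f ξ) =
      rightMulOp f ((x : Space G μ →L[ℂ] Space G μ) ξ) := by
  refine crossedProduct_commute (fun f' => ?_) (fun g => ?_) x ξ
  · ext1 η
    ext1
    funext k
    exact mulL2_comm ..
  · ext1 η
    ext1
    funext k
    simp only [mul_apply_eq_comp, groupOp_apply, rightMulOp_apply,
      koopman_mulL2_translate, mul_inv_cancel_left]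

theorem apply_rightGroupOp (x : (crossedProduct G μ).Elem) (g : G) (ξ : Space G μ) :
    (x : Space G μ →L[ℂ] Space G μ) (rightGroupOp g ξ) =
      rightGroupOp g ((x : Space G μ →L[ℂ] Space G μ) ξ) := by
  refine crossedProduct_commute (fun f => ?_) (fun h => ?_) x ξ
  · ext1 η
    ext1
    funext k
    rw [mul_apply_eq_comp, mul_apply_eq_comp, mulOp_apply, rightGroupOp_apply, rightGroupOp_apply,
      mulOp_apply]
  · ext1 η
    ext1
    funext k
    simp only [mul_apply_eq_comp, groupOp_apply, rightGroupOp_apply, mul_assoc]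

variable [IsProbabilityMeasure μ]

variable (G μ) in
/-- The unitary `u_g` as an element of the crossed product. -/
def ofGroup (g : G) : (crossedProduct G μ).Elem :=
  ⟨groupOp μ g, StarAlgebra.adjoin_le_centralizer_centralizer ℂ _
    (StarAlgebra.subset_adjoin ℂ _ (Or.inr ⟨g, rfl⟩))⟩

/-- The vector `x (1 ⊗ δ_e)`, whose entries are the Fourier coefficients of `x`. -/
def coeffVec (x : (crossedProduct G μ).Elem) : Space G μ :=
  (x : Space G μ →L[ℂ] Space G μ) (vacuum G μ)

theorem groupOp_vacuum (g : G) : groupOp μ g (vacuum G μ) = rightGroupOp g⁻¹ (vacuum G μ) := by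
  ext1
  funext k
  rw [groupOp_apply, rightGroupOp_apply]
  by_cases hk : k = g
  · subst hk
    rw [inv_mul_cancel, mul_inv_cancel, vacuum_apply_one]
    exact Lp.toLp_compMeasurePreserving (memLp_const 1) (measurePreserving_smul k⁻¹ μ)
  · rw [vacuum_apply_of_ne, vacuum_apply_of_ne, map_zero]
    · exact fun h => hk (mul_inv_eq_one.1 h)
    · exact fun h => hk (inv_mul_eq_one.1 h).symm

theorem mulOp_vacuum (f : Lp ℂ ∞ μ) : mulOp G f (vacuum G μ) = rightMulOp f (vacuum G μ) := by
  ext1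
  funext k
  rw [mulOp_apply, rightMulOp_apply]
  by_cases hk : k = 1
  · rw [hk, translate_one]
  · rw [vacuum_apply_of_ne hk, map_zero, map_zero]

theorem twoNorm_eq (x : (crossedProduct G μ).Elem) : twoNorm (trace G μ) x = ‖coeffVec x‖ := by
  have h : trace G μ (star x * x) = inner ℂ (coeffVec x) (coeffVec x) :=
    ContinuousLinearMap.adjoint_inner_right (x : Space G μ →L[ℂ] Space G μ) _ _
  rw [twoNorm, h, @norm_eq_sqrt_re_inner ℂ]
  rfl

theorem norm_coeffVec_le (x : (crossedProduct G μ).Elem) :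
    ‖coeffVec x‖ ≤ ‖(x : Space G μ →L[ℂ] Space G μ)‖ := by
  simpa [norm_vacuum] using! (x : Space G μ →L[ℂ] Space G μ).le_opNorm (vacuum G μ)

theorem coeffVec_mul (x y : (crossedProduct G μ).Elem) :
    coeffVec (x * y) = (x : Space G μ →L[ℂ] Space G μ) (coeffVec y) := rfl

theorem coeffVec_sub (x y : (crossedProduct G μ).Elem) :
    coeffVec (x - y) = coeffVec x - coeffVec y := rfl

theorem coeffVec_ofLinfty (f : Lp ℂ ∞ μ) :
    coeffVec (ofLinfty G μ f) = rightMulOp f (vacuum G μ) := mulOp_vacuum f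

theorem coeffVec_mul_ofLinfty (x : (crossedProduct G μ).Elem) (f : Lp ℂ ∞ μ) :
    coeffVec (x * ofLinfty G μ f) = rightMulOp f (coeffVec x) := by
  rw [coeffVec_mul, coeffVec_ofLinfty, apply_rightMulOp, coeffVec]

theorem coeffVec_mul_ofGroup (x : (crossedProduct G μ).Elem) (g : G) :
    coeffVec (x * ofGroup G μ g) = rightGroupOp g⁻¹ (coeffVec x) := by
  rw [coeffVec_mul, coeffVec, ofGroup, groupOp_vacuum, apply_rightGroupOp, coeffVec]

end Operators

end GroupMeasureSpace

/-! ### Functions with small integral on each set of a countable cover -/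

section Convergence

variable {X : Type v} [MeasurableSpace X] {μ : Measure X}

theorem setIntegral_union_le {F : X → ℝ} {A B : Set X} (hA : MeasurableSet A)
    (hB : MeasurableSet B) (hF : Integrable F μ) (h0 : 0 ≤ᵐ[μ] F) :
    ∫ s in A ∪ B, F s ∂μ ≤ (∫ s in A, F s ∂μ) + ∫ s in B, F s ∂μ := by
  rw [← Set.union_sdiff_self, setIntegral_union Set.disjoint_sdiff_right (hB.diff hA)
    hF.integrableOn hF.integrableOn]
  gcongr
  · exact ae_restrict_of_ae h0
  · exact hF.integrableOn
  · exact Set.sdiff_subset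

/-- A uniformly bounded family of non negative functions on a probability space tends to zero in
`L¹` as soon as its integrals over each member of a countable cover tend to zero. -/
theorem tendsto_integral_zero_of_cover [IsProbabilityMeasure μ] {ι : Type*} {l : Filter ι}
    {D : ℕ → Set X} (hD : ∀ i, MeasurableSet (D i)) (hcov : ∀ᵐ s ∂μ, ∃ i, s ∈ D i)
    {F : ι → X → ℝ} (hF : ∀ n, Integrable (F n) μ) (h0 : ∀ n, 0 ≤ᵐ[μ] F n) {C : ℝ}
    (hC : ∀ n, ∀ᵐ s ∂μ, F n s ≤ C) (h : ∀ i, Tendsto (fun n => ∫ s in D i, F n s ∂μ) l (𝓝 0)) :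
    Tendsto (fun n => ∫ s, F n s ∂μ) l (𝓝 0) := by
  have hacc : ∀ N, MeasurableSet (Set.accumulate D N) := fun N => by
    rw [Set.accumulate_def]
    exact MeasurableSet.biUnion (Set.to_countable _) fun i _ => hD i
  have hset : ∀ N, Tendsto (fun n => ∫ s in Set.accumulate D N, F n s ∂μ) l (𝓝 0) := by
    intro N
    induction N with
    | zero => simpa [Set.accumulate_def] using h 0
    | succ N ih =>
      refine squeeze_zero (fun n => setIntegral_nonneg_of_ae (h0 n)) (fun n => ?_)
        (by simpa using ih.add (h (N + 1)))
      rw [Set.accumulate_succ]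
      exact setIntegral_union_le (hacc N) (hD _) (hF n) (h0 n)
  have htail : Tendsto (fun N => C * μ.real (Set.accumulate D N)ᶜ) atTop (𝓝 0) := by
    have h1 := tendsto_measure_iUnion_accumulate (μ := μ) (f := D)
    have h2 : μ (⋃ i, D i) = 1 := by
      rw [← prob_compl_eq_zero_iff (MeasurableSet.iUnion hD)]
      rw [ae_iff] at hcov
      convert hcov using 2
      ext s
      simp
    rw [h2] at h1
    have h3 := ((ENNReal.tendsto_toReal ENNReal.one_ne_top).comp h1).const_sub 1
    simp only [probReal_compl_eq_one_sub (hacc _)]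
    simpa [Function.comp_def, measureReal_def] using h3.const_mul C
  rw [Metric.tendsto_nhds]
  intro ε hε
  obtain ⟨N, hN⟩ := (htail.eventually (gt_mem_nhds (half_pos hε))).exists
  filter_upwards [(hset N).eventually (gt_mem_nhds (half_pos hε))] with n hn
  rw [Real.dist_0_eq_abs, abs_of_nonneg (integral_nonneg_of_ae (h0 n)),
    ← integral_add_compl (hacc N) (hF n)]
  have h4 : ∫ s in (Set.accumulate D N)ᶜ, F n s ∂μ ≤ C * μ.real (Set.accumulate D N)ᶜ := by
    calc ∫ s in (Set.accumulate D N)ᶜ, F n s ∂μ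
        ≤ ∫ s in (Set.accumulate D N)ᶜ, C ∂μ :=
          setIntegral_mono_ae (hF n).integrableOn (integrable_const C).integrableOn (hC n)
      _ = C * μ.real (Set.accumulate D N)ᶜ := by simp [mul_comm]
  linarith

/-- For a map `T` with almost no fixed points, countably many of the sets
`{s | s ∈ U ↮ T s ∈ U}`, with `U` measurable, cover almost all of the space. -/
theorem exists_seq_cover_of_ae_ne [StandardBorelSpace X] {T : X → X} (hne : ∀ᵐ s ∂μ, T s ≠ s) :
    ∃ U : ℕ → Set X, (∀ i, MeasurableSet (U i)) ∧
      ∀ᵐ s ∂μ, ∃ i, ¬ (s ∈ U i ↔ T s ∈ U i) := by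
  obtain ⟨U, hU, hsep⟩ := exists_seq_separating X MeasurableSet.empty Set.univ
  refine ⟨U, hU, ?_⟩
  filter_upwards [hne] with s hs
  by_contra! h
  exact hs (hsep s trivial (T s) trivial h).symm

end Convergence

/-! ### Fourier coefficients and the conditional expectation -/

namespace GroupMeasureSpace

section L2

variable {X : Type v} [MeasurableSpace X] {μ : Measure X}

theorem integrable_norm_sq (ξ : Lp ℂ 2 μ) : Integrable (fun s => ‖ξ s‖ ^ 2) μ :=
  (Lp.memLp ξ).integrable_norm_pow two_ne_zero

theorem norm_sq_eq_integral (ξ : Lp ℂ 2 μ) : ‖ξ‖ ^ 2 = ∫ s, ‖ξ s‖ ^ 2 ∂μ := by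
  have h := inner_self_eq_norm_sq_to_K (𝕜 := ℂ) ξ
  rw [L2.inner_def] at h
  have h2 : ∀ s, inner ℂ (ξ s) (ξ s) = ((‖ξ s‖ ^ 2 : ℝ) : ℂ) := fun s => by
    rw [inner_self_eq_norm_sq_to_K]; norm_cast
  simp only [h2] at h
  rw [integral_complex_ofReal] at h
  exact Complex.ofReal_injective (by simpa using h.symm)

theorem norm_mulL2_sq (f : Lp ℂ ∞ μ) (ξ : Lp ℂ 2 μ) :
    ‖mulL2 f ξ‖ ^ 2 = ∫ s, ‖f s‖ ^ 2 * ‖ξ s‖ ^ 2 ∂μ := by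
  rw [norm_sq_eq_integral]
  refine integral_congr_ae ?_
  filter_upwards [coeFn_mulL2 f ξ] with s hs
  rw [hs, norm_mul, mul_pow]

/-- The indicator function of `B` in `L^∞(X)`. -/
def indicatorLinfty [IsFiniteMeasure μ] {B : Set X} (hB : MeasurableSet B) : Lp ℂ ∞ μ :=
  indicatorConstLp ∞ hB (measure_ne_top μ B) 1

theorem coeFn_indicatorLinfty [IsFiniteMeasure μ] {B : Set X} (hB : MeasurableSet B) :
    indicatorLinfty (μ := μ) hB =ᵐ[μ] B.indicator fun _ => (1 : ℂ) :=
  indicatorConstLp_coeFn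

theorem norm_mulL2_indicator_sq [IsFiniteMeasure μ] {B : Set X} (hB : MeasurableSet B)
    (ξ : Lp ℂ 2 μ) : ‖mulL2 (indicatorLinfty hB) ξ‖ ^ 2 = ∫ s in B, ‖ξ s‖ ^ 2 ∂μ := by
  rw [norm_mulL2_sq, ← integral_indicator hB]
  refine integral_congr_ae ?_
  filter_upwards [coeFn_indicatorLinfty (μ := μ) hB] with s hs
  rw [hs]
  by_cases h : s ∈ B <;> simp [h]

theorem mulL2_sub_mulL2 (f g : Lp ℂ ∞ μ) (ξ : Lp ℂ 2 μ) :
    mulL2 f ξ - mulL2 g ξ = mulL2 (f - g) ξ := by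
  rw [mulL2, mulL2, mulL2, map_sub]
  rfl

end L2

section Coefficients

variable {G : Type u} [Group G] {X : Type v} [MeasurableSpace X] [MulAction G X]
  [MeasurableConstSMul G X] {μ : Measure X} [IsProbabilityMeasure μ] [SMulInvariantMeasure G X μ]

theorem translate_indicator (g : G) {B : Set X} (hB : MeasurableSet B) :
    translate g (indicatorLinfty (μ := μ) hB) =
      indicatorLinfty (measurable_const_smul g⁻¹ hB : MeasurableSet ((g⁻¹ • ·) ⁻¹' B)) := by
  apply Lp.ext
  filter_upwards [coeFn_translate g (indicatorLinfty (μ := μ) hB),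
    coeFn_indicatorLinfty (μ := μ) (measurable_const_smul g⁻¹ hB),
    (measurePreserving_smul g⁻¹ μ).quasiMeasurePreserving.ae
      (coeFn_indicatorLinfty (μ := μ) hB)] with s h1 h2 h3
  rw [h1, h3, h2]
  rfl

theorem norm_coeffVec_mul_ofLinfty_le (x : (crossedProduct G μ).Elem) (f : Lp ℂ ∞ μ) :
    ‖rightMulOp f (coeffVec x)‖ ≤
      ‖(x : Space G μ →L[ℂ] Space G μ)‖ * ‖rightMulOp f (vacuum G μ)‖ := by
  rw [coeffVec, ← apply_rightMulOp]
  exact ContinuousLinearMap.le_opNorm _ _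

open scoped Classical in
theorem rightMulOp_vacuum (f : Lp ℂ ∞ μ) :
    rightMulOp f (vacuum G μ) = lp.single 2 (1 : G) (mulL2 f (Lp.const 2 μ (1 : ℂ))) := by
  ext1
  funext k
  rw [rightMulOp_apply]
  by_cases hk : k = 1
  · rw [hk, vacuum_apply_one, translate_one, lp.single_apply_self]
  · rw [vacuum_apply_of_ne hk, map_zero, lp.single_apply_ne _ _ _ hk]

/-- The Fourier coefficients of `x` are bounded by the operator norm of `x`: since `x` commutes with
right multiplication by indicator functions, `∫_B |ξ_x(g)|² ≤ ‖x‖² μ(B)` for every measurable `B`. -/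
theorem norm_coeffVec_apply_le (x : (crossedProduct G μ).Elem) (g : G) :
    ∀ᵐ s ∂μ, ‖coeffVec x g s‖ ≤ ‖(x : Space G μ →L[ℂ] Space G μ)‖ := by
  classical
  set C := ‖(x : Space G μ →L[ℂ] Space G μ)‖
  have key : (fun s => ‖coeffVec x g s‖ ^ 2) ≤ᵐ[μ] fun _ => C ^ 2 := by
    refine ae_le_of_forall_setIntegral_le (integrable_norm_sq _) (integrable_const _) ?_
    intro B hB _
    -- The translate by `g` of the indicator function of `g⁻¹ B` is that of `B`.
    have hA : MeasurableSet ((g • ·) ⁻¹' B) := measurable_const_smul g hB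
    have htr : translate g (indicatorLinfty (μ := μ) hA) = indicatorLinfty hB := by
      rw [translate_indicator]
      congr 1
      ext s
      simp
    have h1 := (lp.norm_apply_le_norm two_ne_zero _ g).trans
      (norm_coeffVec_mul_ofLinfty_le x (indicatorLinfty (μ := μ) hA))
    rw [rightMulOp_apply, htr, rightMulOp_vacuum, lp.norm_single (by norm_num)] at h1
    have h2 := pow_le_pow_left₀ (norm_nonneg _) h1 2
    rw [mul_pow, norm_mulL2_indicator_sq, norm_mulL2_indicator_sq] at h2
    refine h2.trans_eq ?_
    have h3 : ∫ s in (g • ·) ⁻¹' B, ‖(Lp.const 2 μ (1 : ℂ)) s‖ ^ 2 ∂μ = μ.real B := by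
      rw [integral_congr_ae (g := fun _ => (1 : ℝ))]
      · simp [measureReal_def, measure_preimage_smul]
      · refine ae_restrict_of_ae ?_
        filter_upwards [Lp.coeFn_const (p := 2) (μ := μ) (1 : ℂ)] with s hs
        rw [hs]
        simp
    rw [h3]
    simp [mul_comm, C]
  filter_upwards [key] with s hs
  exact le_of_sq_le_sq hs (norm_nonneg _)

/-- The conditional expectation of `x` onto `L^∞(X)`: the Fourier coefficient of `x` at `e`. -/
def expectation (x : (crossedProduct G μ).Elem) : Lp ℂ ∞ μ :=
  (memLp_top_of_bound (Lp.aestronglyMeasurable (coeffVec x 1)) _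
    (norm_coeffVec_apply_le x 1)).toLp (coeffVec x 1)

theorem norm_expectation_le (x : (crossedProduct G μ).Elem) :
    ‖expectation x‖ ≤ ‖(x : Space G μ →L[ℂ] Space G μ)‖ := by
  have h : ∀ᵐ s ∂μ, ‖expectation x s‖ ≤ ‖(x : Space G μ →L[ℂ] Space G μ)‖ := by
    filter_upwards [MemLp.coeFn_toLp (memLp_top_of_bound (Lp.aestronglyMeasurable (coeffVec x 1)) _
      (norm_coeffVec_apply_le x 1)), norm_coeffVec_apply_le x 1] with s h1 h2
    rw [expectation, h1]
    exact h2
  simpa using Lp.norm_le_of_ae_bound (norm_nonneg _) h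

theorem mulL2_expectation (x : (crossedProduct G μ).Elem) :
    mulL2 (expectation x) (Lp.const 2 μ (1 : ℂ)) = coeffVec x 1 := by
  apply Lp.ext
  filter_upwards [coeFn_mulL2 (expectation x) (Lp.const 2 μ (1 : ℂ)),
    Lp.coeFn_const (p := 2) (μ := μ) (1 : ℂ),
    MemLp.coeFn_toLp (memLp_top_of_bound (Lp.aestronglyMeasurable (coeffVec x 1)) _
      (norm_coeffVec_apply_le x 1))] with s h1 h2 h3
  rw [h1, h2, expectation, h3]
  simp

theorem coeffVec_expectation_one (x : (crossedProduct G μ).Elem) :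
    coeffVec (ofLinfty G μ (expectation x)) 1 = coeffVec x 1 := by
  classical
  rw [coeffVec_ofLinfty, rightMulOp_vacuum, lp.single_apply_self, mulL2_expectation]

theorem coeffVec_ofLinfty_of_ne (f : Lp ℂ ∞ μ) {k : G} (hk : k ≠ 1) :
    coeffVec (ofLinfty G μ f) k = 0 := by
  rw [coeffVec_ofLinfty, rightMulOp_apply, vacuum_apply_of_ne hk, map_zero]

theorem isExpectation_expectation (x : (crossedProduct G μ).Elem) :
    IsExpectation G μ x (expectation x) := by
  classical
  have h : ∀ (b : Lp ℂ ∞ μ) (y : (crossedProduct G μ).Elem),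
      trace G μ (ofLinfty G μ b * y) =
        inner ℂ (Lp.const 2 μ (1 : ℂ)) (mulL2 b (coeffVec y 1)) := fun b y => by
    change inner ℂ (vacuum G μ) (mulOp G b (coeffVec y)) = _
    rw [vacuum, lp.inner_single_left, mulOp_apply]
  intro b
  rw [h, h, coeffVec_expectation_one]

end Coefficients

/-! ### Restricting vectors to subsets of `G` -/

section Restriction

variable {G : Type u} {X : Type v} [MeasurableSpace X] {μ : Measure X}

open scoped Classical in
/-- The projection of `ℓ²(G, L²(X))` onto the vectors supported on `S ⊆ G`. -/
def restrict (S : Set G) : Space G μ →L[ℂ] Space G μ :=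
  lp.mapCLM 2 (fun k => if k ∈ S then ContinuousLinearMap.id ℂ (Lp ℂ 2 μ) else 0) zero_le_one
    (fun k => by split_ifs; exacts [ContinuousLinearMap.norm_id_le, by simp])

theorem restrict_apply_mem {S : Set G} (ξ : Space G μ) {k : G} (hk : k ∈ S) :
    restrict S ξ k = ξ k := by
  classical
  change (if k ∈ S then ContinuousLinearMap.id ℂ (Lp ℂ 2 μ) else 0) (ξ k) = _
  rw [if_pos hk, ContinuousLinearMap.id_apply]

theorem restrict_apply_notMem {S : Set G} (ξ : Space G μ) {k : G} (hk : k ∉ S) :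
    restrict S ξ k = 0 := by
  classical
  change (if k ∈ S then ContinuousLinearMap.id ℂ (Lp ℂ 2 μ) else 0) (ξ k) = _
  rw [if_neg hk, _root_.zero_apply]

theorem norm_restrict_le (S : Set G) (ξ : Space G μ) : ‖restrict S ξ‖ ≤ ‖ξ‖ := by
  simpa using (restrict S).le_of_opNorm_le (lp.norm_mapCLM_le ..) ξ

theorem norm_restrict_union_sq {A B : Set G} (h : Disjoint A B) (ξ : Space G μ) :
    ‖restrict (A ∪ B) ξ‖ ^ 2 = ‖restrict A ξ‖ ^ 2 + ‖restrict B ξ‖ ^ 2 := by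
  have hsum : restrict (A ∪ B) ξ = restrict A ξ + restrict B ξ := by
    ext1
    funext k
    rw [lp.coeFn_add, Pi.add_apply]
    by_cases hA : k ∈ A
    · rw [restrict_apply_mem _ (Set.mem_union_left B hA), restrict_apply_mem _ hA,
        restrict_apply_notMem _ (h.notMem_of_mem_left hA), add_zero]
    · rw [restrict_apply_notMem _ hA, zero_add]
      by_cases hB : k ∈ B
      · rw [restrict_apply_mem _ (Set.mem_union_right A hB), restrict_apply_mem _ hB]
      · rw [restrict_apply_notMem _ hB, restrict_apply_notMem _ (fun h : k ∈ A ∪ B => h.elim hA hB)]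
  have horth : inner ℂ (restrict A ξ) (restrict B ξ) = 0 := by
    rw [lp.inner_eq_tsum]
    refine (tsum_congr fun k => ?_).trans tsum_zero
    by_cases hA : k ∈ A
    · rw [restrict_apply_notMem _ (h.notMem_of_mem_left hA), inner_zero_right]
    · rw [restrict_apply_notMem _ hA, inner_zero_left]
  rw [hsum, sq, sq, sq, norm_add_sq_eq_norm_sq_add_norm_sq_of_inner_eq_zero (𝕜 := ℂ) _ _ horth]

theorem norm_restrict_mono {A B : Set G} (h : A ⊆ B) (ξ : Space G μ) :
    ‖restrict A ξ‖ ≤ ‖restrict B ξ‖ := by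
  have h1 := norm_restrict_union_sq (Set.disjoint_sdiff_right (s := A) (t := B)) ξ
  rw [Set.union_sdiff_cancel h] at h1
  nlinarith [sq_nonneg ‖restrict (B \ A) ξ‖, norm_nonneg (restrict A ξ),
    norm_nonneg (restrict B ξ)]

theorem norm_restrict_singleton (g : G) (ξ : Space G μ) : ‖restrict {g} ξ‖ = ‖ξ g‖ := by
  classical
  have h : restrict {g} ξ = lp.single 2 g (ξ g) := by
    ext1
    funext k
    by_cases hk : k = g
    · subst hk
      rw [restrict_apply_mem _ (Set.mem_singleton k), lp.single_apply_self]
    · rw [restrict_apply_notMem _ (Set.mem_singleton_iff.not.2 hk), lp.single_apply_ne _ _ _ hk]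
  rw [h, lp.norm_single (by norm_num)]

variable [Group G]

theorem norm_rightGroupOp_apply (g : G) (ξ : Space G μ) : ‖rightGroupOp g ξ‖ = ‖ξ‖ := by
  have h2 : 0 < (2 : ℝ≥0∞).toReal := by norm_num
  rw [lp.norm_eq_tsum_rpow h2, lp.norm_eq_tsum_rpow h2 ξ,
    ← (Equiv.mulRight g).tsum_eq (fun h => ‖ξ h‖ ^ (2 : ℝ≥0∞).toReal)]
  rfl

variable [MulAction G X] [MeasurableConstSMul G X] [SMulInvariantMeasure G X μ]

/-- Conjugation `ξ ↦ u_g ξ u_g⁻¹` maps vectors supported on `B` to vectors supported on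
`g B g⁻¹`. -/
theorem restrict_conj (g : G) (B : Set G) (ξ : Space G μ) :
    restrict ((fun h => g * h * g⁻¹) '' B) (rightGroupOp g (groupOp μ g ξ)) =
      rightGroupOp g (groupOp μ g (restrict B ξ)) := by
  have hmem : ∀ k, k ∈ (fun h => g * h * g⁻¹) '' B ↔ g⁻¹ * (k * g) ∈ B := fun k => by
    constructor
    · rintro ⟨h, hh, rfl⟩
      simpa [mul_assoc] using hh
    · exact fun hk => ⟨_, hk, by simp [mul_assoc]⟩
  ext1
  funext k
  rw [rightGroupOp_apply, groupOp_apply]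
  by_cases hk : g⁻¹ * (k * g) ∈ B
  · rw [restrict_apply_mem _ ((hmem k).2 hk), restrict_apply_mem _ hk, rightGroupOp_apply,
      groupOp_apply]
  · rw [restrict_apply_notMem _ (mt (hmem k).1 hk), restrict_apply_notMem _ hk, map_zero]

/-- The right hand side is the norm of `ξ u_g - u_g ξ`. -/
theorem abs_norm_restrict_conj_sub_le (g : G) (B : Set G) (ξ : Space G μ) :
    |‖restrict ((fun h => g * h * g⁻¹) '' B) ξ‖ - ‖restrict B ξ‖| ≤
      ‖rightGroupOp g⁻¹ ξ - groupOp μ g ξ‖ := by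
  have h1 : ‖restrict B ξ‖ =
      ‖restrict ((fun h => g * h * g⁻¹) '' B) (rightGroupOp g (groupOp μ g ξ))‖ := by
    rw [restrict_conj, norm_rightGroupOp_apply, norm_groupOp_apply]
  have h2 : rightGroupOp g (rightGroupOp g⁻¹ ξ) = ξ := by
    ext1
    funext k
    rw [rightGroupOp_apply, rightGroupOp_apply, mul_inv_cancel_right]
  calc _ ≤ ‖restrict ((fun h => g * h * g⁻¹) '' B) ξ -
        restrict ((fun h => g * h * g⁻¹) '' B) (rightGroupOp g (groupOp μ g ξ))‖ := by
        rw [h1]; exact abs_norm_sub_norm_le _ _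
    _ ≤ ‖ξ - rightGroupOp g (groupOp μ g ξ)‖ := by
        rw [← map_sub]; exact norm_restrict_le _ _
    _ = ‖rightGroupOp g⁻¹ ξ - groupOp μ g ξ‖ := by
        rw [← norm_rightGroupOp_apply g (rightGroupOp g⁻¹ ξ - _), map_sub, h2]

end Restriction

/-! ### Central sequences -/

section CentralSequences

variable {G : Type u} [Group G] {X : Type v} [MeasurableSpace X] [MulAction G X]
  [MeasurableConstSMul G X] {μ : Measure X} [IsProbabilityMeasure μ] [SMulInvariantMeasure G X μ]

theorem twoNorm_sub_expectation (x : (crossedProduct G μ).Elem) :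
    twoNorm (trace G μ) (x - ofLinfty G μ (expectation x)) =
      ‖restrict {1}ᶜ (coeffVec x)‖ := by
  rw [twoNorm_eq, coeffVec_sub]
  congr 1
  ext1
  funext k
  rw [lp.coeFn_sub, Pi.sub_apply]
  by_cases hk : k = 1
  · rw [restrict_apply_notMem _ (by simpa using hk), hk, coeffVec_expectation_one, sub_self]
  · rw [restrict_apply_mem _ (by simpa using hk), coeffVec_ofLinfty_of_ne _ hk, sub_zero]

/-- If `x` almost commutes with `L^∞(X)`, then its coefficient at `g` is concentrated near the
fixed points of `g`: commuting with the indicator function of `U` makes this coefficient small on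
the set where `s ∈ U` and `g⁻¹ s ∈ U` are not equivalent. -/
theorem setIntegral_coeffVec_sq_le (x : (crossedProduct G μ).Elem) (g : G) {U : Set X}
    (hU : MeasurableSet U) :
    ∫ s in {s | ¬ (s ∈ U ↔ g⁻¹ • s ∈ U)}, ‖coeffVec x g s‖ ^ 2 ∂μ ≤
      twoNorm (trace G μ)
        (x * ofLinfty G μ (indicatorLinfty hU) - ofLinfty G μ (indicatorLinfty hU) * x) ^ 2 := by
  have hU' : MeasurableSet ((g⁻¹ • ·) ⁻¹' U) := measurable_const_smul g⁻¹ hU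
  have hD : MeasurableSet {s | ¬ (s ∈ U ↔ g⁻¹ • s ∈ U)} :=
    (hU.iff hU').compl
  have h1 : ∫ s in {s | ¬ (s ∈ U ↔ g⁻¹ • s ∈ U)}, ‖coeffVec x g s‖ ^ 2 ∂μ =
      ‖mulL2 (translate g (indicatorLinfty hU)) (coeffVec x g) -
        mulL2 (indicatorLinfty hU) (coeffVec x g)‖ ^ 2 := by
    rw [mulL2_sub_mulL2, norm_mulL2_sq, ← integral_indicator hD, translate_indicator]
    refine integral_congr_ae ?_
    filter_upwards [Lp.coeFn_sub (indicatorLinfty (μ := μ) hU') (indicatorLinfty hU),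
      coeFn_indicatorLinfty (μ := μ) hU', coeFn_indicatorLinfty (μ := μ) hU] with s h2 h3 h4
    rw [h2, Pi.sub_apply, h3, h4]
    by_cases hs : s ∈ U <;> by_cases hs' : g⁻¹ • s ∈ U <;> simp [hs, hs']
  rw [h1, twoNorm_eq, coeffVec_sub, coeffVec_mul_ofLinfty]
  gcongr
  exact lp.norm_apply_le_norm two_ne_zero
    (rightMulOp (indicatorLinfty hU) (coeffVec x) - mulOp G (indicatorLinfty hU) (coeffVec x)) g

/-- The Fourier coefficients of a central sequence at an element `g` acting freely tend to zero. The
cover by sets where `s ∈ U` and `g⁻¹ s ∈ U` are not equivalent is only countable, and the uniform bound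
on the coefficients controls the remainder after finitely many of them. -/
theorem _root_.IsCentralSequence.tendsto_norm_coeffVec_apply [StandardBorelSpace X]
    {l : Filter ℕ} {x : ℕ → (crossedProduct G μ).Elem}
    (hx : IsCentralSequence (trace G μ) l x) {g : G} (hg : ∀ᵐ s ∂μ, g⁻¹ • s ≠ s) :
    Tendsto (fun n => ‖coeffVec (x n) g‖) l (𝓝 0) := by
  obtain ⟨C, hC⟩ := hx.bounded
  obtain ⟨U, hU, hcov⟩ := exists_seq_cover_of_ae_ne hg
  have hsq : Tendsto (fun n => ‖coeffVec (x n) g‖ ^ 2) l (𝓝 0) := by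
    simp only [norm_sq_eq_integral]
    refine tendsto_integral_zero_of_cover (C := C ^ 2)
      (D := fun i => {s | ¬ (s ∈ U i ↔ g⁻¹ • s ∈ U i)})
      (fun i => ((hU i).iff (measurable_const_smul g⁻¹ (hU i))).compl) hcov
      (fun n => integrable_norm_sq _) (fun n => Eventually.of_forall fun s => sq_nonneg _)
      (fun n => ?_) (fun i => ?_)
    · filter_upwards [norm_coeffVec_apply_le (x n) g] with s hs
      exact pow_le_pow_left₀ (norm_nonneg _) (hs.trans (hC n)) 2
    · refine squeeze_zero (fun n => integral_nonneg fun s => sq_nonneg _)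
        (fun n => setIntegral_coeffVec_sq_le (x n) g (hU i)) ?_
      simpa using (hx.central (ofLinfty G μ (indicatorLinfty (hU i)))).pow 2
  simpa [Real.sqrt_sq] using hsq.sqrt

theorem _root_.IsCentralSequence.tendsto_norm_conj {l : Filter ℕ}
    {x : ℕ → (crossedProduct G μ).Elem} (hx : IsCentralSequence (trace G μ) l x) (g : G) :
    Tendsto (fun n => ‖rightGroupOp g⁻¹ (coeffVec (x n)) - groupOp μ g (coeffVec (x n))‖) l
      (𝓝 0) := by
  refine (hx.central (ofGroup G μ g)).congr fun n => ?_
  rw [twoNorm_eq, coeffVec_sub, coeffVec_mul_ofGroup]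
  rfl

end CentralSequences

/-! ### The limit mean and inner amenability -/

section Mean

variable {G : Type u} [Group G] {X : Type v} [MeasurableSpace X] [MulAction G X]
  [MeasurableConstSMul G X] {μ : Measure X} [IsProbabilityMeasure μ] [SMulInvariantMeasure G X μ]

/-- The part of the mass `‖x‖₂²` carried by the Fourier coefficients indexed by `B \ {e}`, as a
fraction of the mass `‖x - E_A(x)‖₂²` carried by `G \ {e}`. It is zero when `x ∈ L^∞(X)`, by the
convention `0 / 0 = 0`. -/
def offDiagMass (x : (crossedProduct G μ).Elem) (B : Set G) : ℝ :=
  ‖restrict (B \ {1}) (coeffVec x)‖ ^ 2 / ‖restrict {1}ᶜ (coeffVec x)‖ ^ 2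

theorem offDiagMass_mem_Icc (x : (crossedProduct G μ).Elem) (B : Set G) :
    offDiagMass x B ∈ Set.Icc (0 : ℝ) 1 := by
  refine ⟨by unfold offDiagMass; positivity, div_le_one_of_le₀ ?_ (by positivity)⟩
  gcongr
  exact norm_restrict_mono (fun k hk => hk.2) _

theorem offDiagMass_union (x : (crossedProduct G μ).Elem) {A B : Set G} (h : Disjoint A B) :
    offDiagMass x (A ∪ B) = offDiagMass x A + offDiagMass x B := by
  rw [offDiagMass, Set.union_sdiff_distrib,
    norm_restrict_union_sq (h.mono Set.sdiff_subset Set.sdiff_subset), add_div]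
  rfl

/-- The mass of `B` and that of `g B g⁻¹` differ by little if `x` almost commutes with `u_g`. -/
theorem abs_offDiagMass_conj_sub_le (x : (crossedProduct G μ).Elem) (g : G) (B : Set G) {ε C : ℝ}
    (hε : 0 < ε) (hx : ε ≤ ‖restrict {1}ᶜ (coeffVec x)‖) (hC : ‖coeffVec x‖ ≤ C) :
    |offDiagMass x ((fun h => g * h * g⁻¹) '' B) - offDiagMass x B| ≤
      2 * C / ε ^ 2 * ‖rightGroupOp g⁻¹ (coeffVec x) - groupOp μ g (coeffVec x)‖ := by
  have himg : (fun h => g * h * g⁻¹) '' B \ {1} = (fun h => g * h * g⁻¹) '' (B \ {1}) := by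
    have h := Set.image_sdiff (MulAut.conj g).injective B {1}
    rw [Set.image_singleton, map_one] at h
    exact h.symm
  have h1 := abs_norm_restrict_conj_sub_le (μ := μ) g (B \ {1}) (coeffVec x)
  have h2 := (norm_restrict_le ((fun h => g * h * g⁻¹) '' (B \ {1})) (coeffVec x)).trans hC
  have h3 := (norm_restrict_le (B \ {1}) (coeffVec x)).trans hC
  have hC0 : 0 ≤ C := (norm_nonneg _).trans hC
  rw [offDiagMass, offDiagMass, himg, ← sub_div, sq_sub_sq, abs_div, abs_mul,
    abs_of_nonneg (add_nonneg (norm_nonneg _) (norm_nonneg _)),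
    abs_of_nonneg (sq_nonneg ‖restrict {1}ᶜ (coeffVec x)‖),
    div_mul_eq_mul_div]
  exact div_le_div₀ (by positivity)
    (mul_le_mul (by linarith) h1 (abs_nonneg _) (by positivity)) (by positivity) (by gcongr)

/-- If along some ultrafilter a central sequence stays away from `L^∞(X)`, then the distribution
of its Fourier coefficients converges to a diffuse conjugation invariant mean. -/
theorem isInnerAmenable_of_isCentralSequence [StandardBorelSpace X]
    (hfree : IsEssentiallyFree G μ) {U : Ultrafilter ℕ} {x : ℕ → (crossedProduct G μ).Elem}
    (hx : IsCentralSequence (trace G μ) U x) {ε : ℝ} (hε : 0 < ε)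
    (hlow : ∀ᶠ n in U, ε ≤ ‖restrict {1}ᶜ (coeffVec (x n))‖) : IsInnerAmenable G := by
  obtain ⟨C, hC⟩ := hx.bounded
  obtain ⟨m, hm, hlim⟩ := (isCompact_univ_pi fun _ : Set G => isCompact_Icc (a := (0 : ℝ))
    (b := 1)).ultrafilter_le_nhds (U.map fun n => offDiagMass (x n))
    (le_principal_iff.2 (mem_map.2 (Eventually.of_forall fun n B _ => offDiagMass_mem_Icc (x n) B)))
  have hlim : ∀ B, Tendsto (fun n => offDiagMass (x n) B) U (𝓝 (m B)) :=
    tendsto_pi_nhds.1 hlim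
  have hunion : ∀ A B, Disjoint A B → m (A ∪ B) = m A + m B := fun A B h =>
    tendsto_nhds_unique (hlim (A ∪ B)) <| by
      simpa only [offDiagMass_union _ h] using (hlim A).add (hlim B)
  have hsingle : ∀ g, m {g} = 0 := fun g => by
    refine tendsto_nhds_unique (hlim {g}) ?_
    by_cases hg : g = 1
    · subst hg
      refine tendsto_const_nhds.congr fun n => ?_
      have h0 := norm_restrict_union_sq (Set.disjoint_empty (∅ : Set G)) (coeffVec (x n))
      rw [Set.union_empty] at h0
      rw [offDiagMass, sdiff_self, Set.bot_eq_empty, left_eq_add.1 h0, zero_div]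
    · have h1 := (hx.tendsto_norm_coeffVec_apply (hfree g⁻¹ (inv_ne_one.2 hg))).pow 2
      refine squeeze_zero' (Eventually.of_forall fun n => (offDiagMass_mem_Icc _ _).1) ?_
        (by simpa using h1.div_const (ε ^ 2))
      filter_upwards [hlow] with n hn
      have hset : ({g} : Set G) \ {1} = {g} := by simpa using hg
      rw [offDiagMass, hset, norm_restrict_singleton]
      gcongr
  refine ⟨m, fun A => (hm A trivial).1, ?_, hunion, fun g A => ?_, fun F hF => ?_⟩
  · refine tendsto_nhds_unique (hlim Set.univ) (tendsto_const_nhds.congr' ?_)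
    filter_upwards [hlow] with n hn
    rw [offDiagMass, ← Set.compl_eq_univ_sdiff, div_self (pow_pos (hε.trans_le hn) 2).ne']
  · have h1 : Tendsto (fun n => offDiagMass (x n) ((fun h => g * h * g⁻¹) '' A) -
        offDiagMass (x n) A) U (𝓝 0) := by
      refine squeeze_zero_norm' ?_ (by
        simpa using (hx.tendsto_norm_conj g).const_mul (2 * C / ε ^ 2))
      filter_upwards [hlow] with n hn
      exact abs_offDiagMass_conj_sub_le (x n) g A hε hn ((norm_coeffVec_le _).trans (hC n))
    exact sub_eq_zero.1 (tendsto_nhds_unique ((hlim _).sub (hlim A)) h1)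
  · induction F, hF using Set.Finite.induction_on with
    | empty => simpa using hunion ∅ ∅ (Set.disjoint_empty _)
    | insert ha _ ih =>
      rw [Set.insert_eq, hunion _ _ (Set.disjoint_singleton_left.2 ha), hsingle, ih, add_zero]

/-- If `G` is not inner amenable, central sequences of `L^∞(X) ⋊ G` are asymptotically contained in
`L^∞(X)`. -/
theorem tendsto_twoNorm_sub_expectation [StandardBorelSpace X] (hG : ¬ IsInnerAmenable G)
    (hfree : IsEssentiallyFree G μ) {l : Filter ℕ} {x : ℕ → (crossedProduct G μ).Elem}
    (hx : IsCentralSequence (trace G μ) l x) :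
    Tendsto (fun n => twoNorm (trace G μ) (x n - ofLinfty G μ (expectation (x n)))) l (𝓝 0) := by
  simp only [twoNorm_sub_expectation]
  by_contra hnot
  refine hG ?_
  rw [Metric.tendsto_nhds] at hnot
  push Not at hnot
  obtain ⟨ε, hε, hfreq⟩ := hnot
  have hne : (l ⊓ 𝓟 {n | ε ≤ ‖restrict {1}ᶜ (coeffVec (x n))‖}).NeBot := by
    rw [← frequently_mem_iff_neBot]
    refine hfreq.mono fun n hn => ?_
    simpa using hn
  obtain ⟨U, hU⟩ := Ultrafilter.exists_le (l ⊓ 𝓟 {n | ε ≤ ‖restrict {1}ᶜ (coeffVec (x n))‖})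
  refine isInnerAmenable_of_isCentralSequence hfree (U := U)
    ⟨hx.bounded, fun a => (hx.central a).mono_left (hU.trans inf_le_left)⟩ hε ?_
  exact le_principal_iff.1 (hU.trans inf_le_right)

/-- Since `L^∞(X)` is commutative, the commutator of `x` and `y` is controlled by their distances
to `L^∞(X)`. -/
theorem twoNorm_commutator_le (x y : (crossedProduct G μ).Elem) {C D : ℝ}
    (hx : ‖(x : Space G μ →L[ℂ] Space G μ)‖ ≤ C) (hy : ‖(y : Space G μ →L[ℂ] Space G μ)‖ ≤ D) :
    twoNorm (trace G μ) (x * y - y * x) ≤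
      2 * (C * twoNorm (trace G μ) (y - ofLinfty G μ (expectation y)) +
        D * twoNorm (trace G μ) (x - ofLinfty G μ (expectation x))) := by
  set a := expectation x
  set b := expectation y
  have ha : ‖rightMulOp (G := G) a‖ ≤ C :=
    (norm_rightMulOp_le a).trans ((norm_expectation_le x).trans hx)
  have hb : ‖rightMulOp (G := G) b‖ ≤ D :=
    (norm_rightMulOp_le b).trans ((norm_expectation_le y).trans hy)
  set r := coeffVec (x - ofLinfty G μ a) with hr
  set s := coeffVec (y - ofLinfty G μ b) with hs
  have hcomm : rightMulOp b (coeffVec (ofLinfty G μ a)) =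
      rightMulOp a (coeffVec (ofLinfty G μ b)) := by
    rw [coeffVec_ofLinfty, coeffVec_ofLinfty]
    ext1
    funext k
    exact mulL2_comm ..
  -- `x y = x (y - b) + (x - a) b + a b`, where right multiplication by `b ∈ L^∞(X)` is bounded
  -- on `ℓ²(G, L²(X))`; so the trace property is not needed.
  have hexp : ∀ (z w : (crossedProduct G μ).Elem) (c d : Lp ℂ ∞ μ), coeffVec (z * w) =
      (z : Space G μ →L[ℂ] Space G μ) (coeffVec (w - ofLinfty G μ d)) +
        rightMulOp d (coeffVec (z - ofLinfty G μ c)) +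
        rightMulOp d (coeffVec (ofLinfty G μ c)) := fun z w c d => by
    rw [add_assoc, ← map_add, coeffVec_sub z, sub_add_cancel, ← coeffVec_mul_ofLinfty,
      coeffVec_sub, map_sub, ← coeffVec_mul, ← coeffVec_mul, sub_add_cancel]
  rw [twoNorm_eq, twoNorm_eq, twoNorm_eq, coeffVec_sub, hexp x y a b, hexp y x b a, hcomm,
    add_sub_add_right_eq_sub, ← hr, ← hs]
  refine (norm_sub_le _ _).trans ?_
  have h1 := (norm_add_le ((x : Space G μ →L[ℂ] Space G μ) s) (rightMulOp b r)).trans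
    (add_le_add (ContinuousLinearMap.le_of_opNorm_le _ hx s)
      (ContinuousLinearMap.le_of_opNorm_le _ hb r))
  have h2 := (norm_add_le ((y : Space G μ →L[ℂ] Space G μ) r) (rightMulOp a s)).trans
    (add_le_add (ContinuousLinearMap.le_of_opNorm_le _ hy r)
      (ContinuousLinearMap.le_of_opNorm_le _ ha s))
  linarith

theorem not_isMcDuffFactor [StandardBorelSpace X] (hG : ¬ IsInnerAmenable G)
    (hfree : IsEssentiallyFree G μ) :
    ¬ IsMcDuffFactor (crossedProduct G μ) (trace G μ) := by
  rintro ⟨_, ω, _, x, y, hx, hy, hxy⟩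
  obtain ⟨C, hC⟩ := hx.bounded
  obtain ⟨D, hD⟩ := hy.bounded
  refine hxy (squeeze_zero (fun n => Real.sqrt_nonneg _)
    (fun n => twoNorm_commutator_le (x n) (y n) (hC n) (hD n)) ?_)
  simpa using (((tendsto_twoNorm_sub_expectation hG hfree hy).const_mul C).add
    ((tendsto_twoNorm_sub_expectation hG hfree hx).const_mul D)).const_mul 2

end Mean

end GroupMeasureSpace

end

theorem proposition4p1 (G : Type u) [Group G] [Countable G] :
    (IsMcDuffGroup.{u, v} G → IsInnerAmenable G) ∧
    (¬ IsInnerAmenable G →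
      ∀ (X : Type v) [MeasurableSpace X] [StandardBorelSpace X] [MulAction G X]
        [MeasurableConstSMul G X] (μ : Measure X) [IsProbabilityMeasure μ] [ErgodicSMul G X μ],
        IsEssentiallyFree G μ →
        (∀ x : ℕ → (GroupMeasureSpace.crossedProduct G μ).Elem,
          IsCentralSequence (GroupMeasureSpace.trace G μ) atTop x →
          ∃ a : ℕ → Lp ℂ ∞ μ,
            (∀ n, GroupMeasureSpace.IsExpectation G μ (x n) (a n)) ∧
            Tendsto (fun n => twoNorm (GroupMeasureSpace.trace G μ)
              (x n - GroupMeasureSpace.ofLinfty G μ (a n))) atTop (𝓝 0)) ∧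
        ¬ IsMcDuffFactor (GroupMeasureSpace.crossedProduct G μ) (GroupMeasureSpace.trace G μ)) := by
  have key : ¬ IsInnerAmenable G →
      ∀ (X : Type v) [MeasurableSpace X] [StandardBorelSpace X] [MulAction G X]
        [MeasurableConstSMul G X] (μ : Measure X) [IsProbabilityMeasure μ] [ErgodicSMul G X μ],
        IsEssentiallyFree G μ →
        ¬ IsMcDuffFactor (GroupMeasureSpace.crossedProduct G μ) (GroupMeasureSpace.trace G μ) :=
    fun hG X _ _ _ _ μ _ _ hfree => GroupMeasureSpace.not_isMcDuffFactor hG hfree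
  refine ⟨?_, fun hG X _ _ _ _ μ _ _ hfree => ⟨fun x hx => ?_, key hG X μ hfree⟩⟩
  · rintro ⟨X, _, _, _, _, μ, _, _, hfree, hM⟩
    by_contra hG
    exact key hG X μ hfree hM
  · exact ⟨fun n => GroupMeasureSpace.expectation (x n),
      fun n => GroupMeasureSpace.isExpectation_expectation (x n),
      GroupMeasureSpace.tendsto_twoNorm_sub_expectation hG hfree hx⟩
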